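/- Let $k\ge 1$, let $\widehat{G}_1,\dots,\widehat{G}_k$ be profinite groups, and let $\Pi=\coprod_{i=1}^k\widehat{G}_i$ be their profinite free product, i.e. the inverse limit of the finite quotients $(\widehat{G}_1*\cdots*\widehat{G}_k)/N$ of the abstract free product, where $N$ runs over the normal subgroups of finite index such that $N\cap\widehat{G}_i$ is open in $\widehat{G}_i$ for every $i$ (equivalently, the coproduct of the $\widehat{G}_i$ in the category of profinite groups). Each canonical homomorphism $\widehat{G}_i\to\Pi$ is injective, and $\widehat{G}_i$ is identified with its image in $\Pi$. Let $\widehat{H}\le\widehat{G}_1$ be a nontrivial closed subgroup. Then the normalizer of $\widehat{H}$ in $\Pi$ equals the normalizer of $\widehat{H}$ in $\widehat{G}_1$: $$N_{\Pi}(\widehat{H})=N_{\widehat{G}_1}(\widehat{H}).$$ -/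

import Mathlib

open CategoryTheory

universe u

namespace ProfiniteFreeProduct

variable {k : ℕ} (G : Fin k → ProfiniteGrp.{u})

/-- The free product `G₁ * ⋯ * G_k` of the underlying abstract groups. -/
abbrev AbstractFreeProduct : Type u := Monoid.CoprodI fun i => G i

/-- The normal subgroups `N` of finite index of the abstract free product such that `N ∩ G_i` is
open in `G_i` for every `i`, ordered by inclusion. -/
abbrev Level : Type u :=
  {N : FiniteIndexNormalSubgroup (AbstractFreeProduct G) //
    ∀ i, IsOpen {g : G i | (Monoid.CoprodI.of g : AbstractFreeProduct G) ∈ N.toSubgroup}}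

/-- The inverse system of the finite quotients `(G₁ * ⋯ * G_k) / N`. -/
def finiteDiagram : Level G ⥤ FiniteGrp.{u} where
  obj N := FiniteGrp.of (AbstractFreeProduct G ⧸ N.1.toSubgroup)
  map f := FiniteGrp.ofHom <| QuotientGroup.map _ _ (MonoidHom.id _) f.le
  map_id N := by ext ⟨x⟩; rfl
  map_comp f g := by ext ⟨x⟩; rfl

/-- The same inverse system, of finite discrete groups, in the category of profinite groups. -/
def diagram : Level G ⥤ ProfiniteGrp.{u} :=
  finiteDiagram G ⋙ forget₂ _ _

end ProfiniteFreeProduct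

/-- The profinite free product of the profinite groups `G₁, …, G_k`: the inverse limit of the
finite quotients of the abstract free product by the normal subgroups of finite index that meet
every `G_i` in an open subgroup. -/
def ProfiniteFreeProduct {k : ℕ} (G : Fin k → ProfiniteGrp.{u}) : ProfiniteGrp.{u} :=
  ProfiniteGrp.limit (ProfiniteFreeProduct.diagram G)

namespace ProfiniteFreeProduct

variable {k : ℕ} (G : Fin k → ProfiniteGrp.{u})

/-- The canonical homomorphism of the abstract free product to the profinite one. -/
def eta : AbstractFreeProduct G →* ProfiniteFreeProduct G where
  toFun x := ⟨fun _ => QuotientGroup.mk x, fun _ _ _ => rfl⟩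
  map_one' := rfl
  map_mul' _ _ := rfl

/-- The canonical continuous homomorphism of the factor `G_i` to the profinite free product. -/
def inclusion (i : Fin k) : G i →ₜ* ProfiniteFreeProduct G where
  toMonoidHom := (eta G).comp (Monoid.CoprodI.of (M := fun i => G i) (i := i))
  continuous_toFun := by
    refine continuous_induced_rng.mpr (continuous_pi fun N => ?_)
    let q : G i →* AbstractFreeProduct G ⧸ N.1.toSubgroup :=
      (QuotientGroup.mk' N.1.toSubgroup).comp (Monoid.CoprodI.of (M := fun i => G i) (i := i))
    let _ : TopologicalSpace (AbstractFreeProduct G ⧸ N.1.toSubgroup) := ⊥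
    have _ : DiscreteTopology (AbstractFreeProduct G ⧸ N.1.toSubgroup) := ⟨rfl⟩
    have hq : Continuous q := by
      refine continuous_of_continuousAt_one q ?_
      rw [ContinuousAt, map_one, nhds_discrete (AbstractFreeProduct G ⧸ N.1.toSubgroup),
        Filter.tendsto_pure]
      refine Filter.mem_of_superset ((N.2 i).mem_nhds ?_) fun g hg => ?_
      · simp
      · exact (QuotientGroup.eq_one_iff _).mpr hg
    exact hq

theorem denseRange_eta : DenseRange (eta G) := by
  apply dense_iff_inter_open.mpr
  rintro U ⟨s, hsO, hsv⟩ ⟨⟨spc, hspc⟩, hmem⟩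
  subst hsv
  replace hmem : spc ∈ s := hmem
  rcases (isOpen_pi_iff.mp hsO) _ hmem with ⟨J, fJ, hJ1, hJ2⟩
  let M : Subgroup (AbstractFreeProduct G) := iInf fun (j : J) => j.val.1.toSubgroup
  have hM : M.Normal := Subgroup.normal_iInf_normal fun j => inferInstance
  have hMFinite : M.FiniteIndex := by
    apply Subgroup.finiteIndex_iInf
    infer_instance
  let m : Level G := ⟨{ toSubgroup := M }, fun i => by
    have h : {g : G i | (Monoid.CoprodI.of g : AbstractFreeProduct G) ∈ M} =
        ⋂ j : J, {g : G i | (Monoid.CoprodI.of g : AbstractFreeProduct G) ∈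
          j.val.1.toSubgroup} := by
      ext g
      simp [M, Subgroup.mem_iInf]
    change IsOpen {g : G i | (Monoid.CoprodI.of g : AbstractFreeProduct G) ∈ M}
    rw [h]
    exact isOpen_iInter_of_finite fun j => j.val.2 i⟩
  rcases QuotientGroup.mk'_surjective M (spc m) with ⟨origin, horigin⟩
  refine ⟨eta G origin, ?_, origin, rfl⟩
  apply hJ2
  intro a ha
  have hle : m ≤ a := iInf_le (fun j : J => j.val.1.toSubgroup) ⟨a, ha⟩
  have h1 := (eta G origin).property hle.hom
  have h2 := hspc hle.hom
  have h3 : (eta G origin).val m = spc m := horigin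
  rw [← h1, h3]
  exact Set.mem_of_eq_of_mem h2 (hJ1 a ha).right

variable {G}

/-- Existence part of the universal property of the profinite free product. -/
theorem exists_lift {P : ProfiniteGrp.{u}} (f : ∀ i, G i →ₜ* P) :
    ∃ F : ProfiniteFreeProduct G →ₜ* P, ∀ i g, F (inclusion G i g) = f i g := by
  let φ : AbstractFreeProduct G →* P := Monoid.CoprodI.lift fun i => (f i).toMonoidHom
  have hφ : ∀ i (g : G i), φ (Monoid.CoprodI.of g) = f i g := fun i g =>
    Monoid.CoprodI.lift_of _ _
  let pre : OpenNormalSubgroup P → Level G := fun U =>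
    ⟨U.toFiniteIndexNormalSubgroup.comap φ, fun i => by
      have h : {g : G i | (Monoid.CoprodI.of g : AbstractFreeProduct G) ∈
          (U.toFiniteIndexNormalSubgroup.comap φ).toSubgroup} = f i ⁻¹' (U : Set P) := by
        ext g
        change φ (Monoid.CoprodI.of g) ∈ U ↔ _
        rw [hφ]
        rfl
      rw [h]
      exact U.isOpen'.preimage (f i).continuous_toFun⟩
  let qm : ∀ U : OpenNormalSubgroup P,
      FiniteGrp.of (AbstractFreeProduct G ⧸ (pre U).1.toSubgroup) ⟶
        FiniteGrp.of (P ⧸ U.toSubgroup) := fun U =>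
    FiniteGrp.ofHom <| QuotientGroup.map _ _ φ <| fun _ h => h
  let F : ProfiniteFreeProduct G ⟶ P := P.isLimitCone.lift ⟨_, {
    app := fun U => (ProfiniteGrp.limitCone (diagram G)).π.app (pre U) ≫
      ProfiniteGrp.ofFiniteGrpHom (qm U)
    naturality := by
      intro X Y g
      ext ⟨x, hx⟩
      change qm Y (x (pre Y)) = P.diagram.map g (qm X (x (pre X)))
      have hle : pre X ≤ pre Y := fun a ha => g.le ha
      have h := hx hle.hom
      obtain ⟨t, ht⟩ : ∃ t : AbstractFreeProduct G, QuotientGroup.mk t = x (pre X) :=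
        QuotientGroup.mk_surjective (x (pre X))
      rw [← h, ← ht]
      rfl }⟩
  refine ⟨F.hom, fun i g => ?_⟩
  apply P.toLimit_injective
  refine Subtype.ext (funext fun U => ?_)
  have h := ConcreteCategory.congr_hom (P.isLimitCone.fac _ U : F ≫ P.cone.π.app U = _)
    (inclusion G i g)
  refine h.trans ?_
  change (QuotientGroup.mk (φ (Monoid.CoprodI.of g)) : P ⧸ U.toSubgroup) = QuotientGroup.mk (f i g)
  rw [hφ]

/-- Uniqueness part of the universal property of the profinite free product. -/
theorem lift_unique {P : ProfiniteGrp.{u}} (F F' : ProfiniteFreeProduct G →ₜ* P)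
    (h : ∀ i g, F (inclusion G i g) = F' (inclusion G i g)) : F = F' := by
  have h1 : F.toMonoidHom.comp (eta G) = F'.toMonoidHom.comp (eta G) := by
    refine Monoid.CoprodI.ext_hom _ _ fun i => ?_
    ext g
    exact h i g
  ext x
  exact congrFun ((denseRange_eta G).equalizer F.continuous_toFun F'.continuous_toFun
    (funext fun y => DFunLike.congr_fun h1 y)) x

variable (G)

/-- Each factor embeds in the profinite free product. -/
theorem inclusion_injective (i : Fin k) : Function.Injective (inclusion G i) := by
  classical
  obtain ⟨F, hF⟩ := exists_lift (G := G) (P := G i)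
    (fun j => if h : j = i then h ▸ ContinuousMonoidHom.id (G j) else 1)
  intro x y hxy
  have h := congrArg F hxy
  rw [hF, hF] at h
  simpa using h

end ProfiniteFreeProduct

/-! The first factor is malnormal: one nontrivial `h` in it conjugated into it by `g` forces `g`
into it. Dividing `g` by its image under the retraction onto the factor reduces this to `g`
commuting with `h`. Work in a finite quotient `Q` where `h` has order `n > 1`, and let `A` be the
image of the factor. The principal derivation `x ↦ [xA] - [A]` into `(ℤ/n)[Q/A]` lifts to
`(ℤ/n)[Q]`: derivations may be chosen freely on each factor, so take zero on the first and `x ↦ [x]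
- [1]` on the others. Such a derivation is a homomorphism to a wreath product. Its value at `g` is
invariant under `h`, so its sum over `A` is a multiple of `n`, hence zero; thus `[gA] = [A]`. -/

/-- The product over a finite group of a function that is invariant under left translation by `h`
is trivial as soon as the values are killed by the order of `h`. -/
theorem prod_eq_one_of_mul_left_invariant {A D : Type*} [Group A] [Fintype A] [CommGroup D]
    (h : A) (f : A → D) (hf : ∀ a, f (h * a) = f a) (hD : ∀ d : D, d ^ orderOf h = 1) :
    ∏ a, f a = 1 := by
  classical
  have hz : ∀ c ∈ Subgroup.zpowers h, ∀ a, f (c * a) = f a := by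
    intro c hc
    obtain ⟨m, rfl⟩ := mem_powers_iff_mem_zpowers.mpr hc
    clear hc
    dsimp only
    induction m with
    | zero => simp
    | succ m ih =>
      intro a
      rw [pow_succ', mul_assoc, hf, ih]
  -- The invariance is along right cosets of `⟨h⟩`; inversion turns them into the left cosets that
  -- form the quotient.
  rw [← Equiv.prod_comp (Equiv.inv A) f,
    ← Finset.prod_fiberwise Finset.univ (fun a : A => (a : A ⧸ Subgroup.zpowers h))]
  refine Finset.prod_eq_one fun z _ => ?_
  obtain ⟨b, rfl⟩ := QuotientGroup.mk_surjective z
  rw [Finset.prod_congr rfl (g := fun _ => f b⁻¹) fun a ha => ?_, Finset.prod_const]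
  · have hcard := QuotientGroup.card_preimage_mk (Subgroup.zpowers h)
      {(b : A ⧸ Subgroup.zpowers h)}
    rw [Nat.card_zpowers, Nat.card_coe_set_eq {(b : A ⧸ Subgroup.zpowers h)},
      Set.ncard_singleton, mul_one, Nat.card_eq_card_toFinset] at hcard
    rw [← hD (f b⁻¹), ← hcard]
    congr 2
    ext a
    simp
  · have hab : b⁻¹ * a ∈ Subgroup.zpowers h :=
      QuotientGroup.eq.mp (Finset.mem_filter.mp ha).2.symm
    simpa using (hz _ hab a⁻¹).symm

namespace RegularWreathProduct

variable {D Q : Type*} [CommGroup D] [Group Q]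

open scoped Classical in
/-- The function on `Q` with value `d` on the subgroup `A` and `1` elsewhere. -/
noncomputable def cosetIndicator (A : Subgroup Q) (d : D) (x : Q) : D := if x ∈ A then d else 1

/-- The elements `w` of `D ≀ᵣ Q` such that the image of `w.left` under summation along the left
cosets of `A` is the principal derivation `[w.right A] - [A]`. -/
def cosetDerivation (A : Subgroup Q) [Fintype A] (d : D) : Submonoid (D ≀ᵣ Q) where
  carrier := {w | ∀ y, ∏ t : A, w.left (y * t) =
    cosetIndicator A d (y⁻¹ * w.right) / cosetIndicator A d y⁻¹}
  one_mem' y := by simp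
  mul_mem' {v w} hv hw y := by
    have h := hw (v.right⁻¹ * y)
    simp only [mul_assoc, mul_inv_rev, inv_inv] at h
    simp only [mul_left, mul_right, Pi.mul_apply, Finset.prod_mul_distrib, hv y, h]
    rw [mul_comm, div_mul_div_cancel]

/-- The zero derivation is a valid lift here because `A` fixes its own coset. -/
theorem inl_mem_cosetDerivation (A : Subgroup Q) [Fintype A] (d : D) {q : Q} (hq : q ∈ A) :
    inl q ∈ cosetDerivation A d := fun y => by
  have h : cosetIndicator A d (y⁻¹ * q) = cosetIndicator A d y⁻¹ := by
    classical exact if_congr (Subgroup.mul_mem_cancel_right A hq) rfl rfl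
  simp [h]

theorem prod_mulSingle (A : Subgroup Q) [Fintype A] [DecidableEq Q] (d : D) (y x : Q) :
    ∏ t : A, (Pi.mulSingle x d : Q → D) (y * t) = cosetIndicator A d (y⁻¹ * x) := by
  classical
  by_cases hy : y⁻¹ * x ∈ A
  · rw [Finset.prod_eq_single ⟨y⁻¹ * x, hy⟩]
    · simp [cosetIndicator, hy]
    · intro t _ ht
      refine Pi.mulSingle_eq_of_ne (M := fun _ : Q => D) (fun h => ht (Subtype.ext ?_)) d
      exact eq_inv_mul_of_mul_eq h
    · simp
  · rw [cosetIndicator, if_neg hy]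
    refine Finset.prod_eq_one fun t _ =>
      Pi.mulSingle_eq_of_ne (M := fun _ : Q => D) (fun h => hy ?_) d
    rw [← h, inv_mul_cancel_left]
    exact t.2

/-- The conjugate has base component `[q] - [1]`, which sums along cosets to `[qA] - [A]`. -/
theorem conj_inl_mem_cosetDerivation (A : Subgroup Q) [Fintype A] [DecidableEq Q] (d : D) (q : Q) :
    MulAut.conj (⟨(Pi.mulSingle 1 d)⁻¹, 1⟩ : D ≀ᵣ Q) (inl q) ∈ cosetDerivation A d := fun y => by
  have h := prod_mulSingle A d (q⁻¹ * y) 1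
  have h' := prod_mulSingle A d y 1
  simp only [mul_assoc, mul_inv_rev, inv_inv, mul_one] at h h'
  simp [Finset.prod_mul_distrib, h, h', mul_comm, div_eq_mul_inv]

end RegularWreathProduct

namespace ProfiniteFreeProduct

open RegularWreathProduct

/-- In a finite quotient `q` that does not kill `h`, the centralizer of `h ∈ G₁` lies in the image
of `G₁`. -/
theorem exists_map_inclusion_eq_of_commute {k : ℕ} (G : Fin (k + 1) → ProfiniteGrp.{u})
    {Q : Type u} [Group Q] [Finite Q] [TopologicalSpace Q] [DiscreteTopology Q]
    (q : ProfiniteFreeProduct G →ₜ* Q) {h : G 0} (hh : q (inclusion G 0 h) ≠ 1)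
    {g : ProfiniteFreeProduct G} (hg : Commute g (inclusion G 0 h)) :
    ∃ t, q (inclusion G 0 t) = q g := by
  classical
  let n := orderOf (q (inclusion G 0 h))
  have hn1 : n ≠ 1 := fun h1 => hh (orderOf_eq_one_iff.mp h1)
  have : NeZero n := ⟨(orderOf_pos _).ne'⟩
  have : Fact (1 < n) := ⟨by have := NeZero.ne n; omega⟩
  let A : Subgroup Q := (q.toMonoidHom.comp (inclusion G 0).toMonoidHom).range
  have _ : Fintype A := Fintype.ofFinite A
  let d : Multiplicative (ZMod n) := Multiplicative.ofAdd 1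
  let _ : TopologicalSpace (Multiplicative (ZMod n) ≀ᵣ Q) := ⊥
  have _ : DiscreteTopology (Multiplicative (ZMod n) ≀ᵣ Q) := ⟨rfl⟩
  have _ : IsTopologicalGroup (Multiplicative (ZMod n) ≀ᵣ Q) := {}
  let c : Fin (k + 1) → (Multiplicative (ZMod n) ≀ᵣ Q) := fun i =>
    if i = 0 then 1 else ⟨(Pi.mulSingle 1 d)⁻¹, 1⟩
  let f : ∀ i, G i →ₜ* ProfiniteGrp.of (Multiplicative (ZMod n) ≀ᵣ Q) := fun i =>
    { toMonoidHom := (((MulAut.conj (c i)).toMonoidHom.comp inl).comp q.toMonoidHom).comp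
        (inclusion G i).toMonoidHom
      continuous_toFun := (continuous_of_discreteTopology (f := fun x : Q =>
        MulAut.conj (c i) (inl x))).comp
          (q.continuous_toFun.comp (inclusion G i).continuous_toFun) }
  obtain ⟨F, hF⟩ := exists_lift f
  let F' : ProfiniteFreeProduct G →* (Multiplicative (ZMod n) ≀ᵣ Q) := F.toMonoidHom
  have hFc : Continuous F' := F.continuous_toFun
  replace hF : ∀ i g, F' (inclusion G i g) = MulAut.conj (c i) (inl (q (inclusion G i g))) := hF
  -- Both conditions are closed, so they need checking only on the dense abstract free product,
  -- factor by factor.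
  have hclosed : IsClosed {x | F' x ∈ cosetDerivation A d ∧ (F' x).right = q x} :=
    ((isClosed_discrete
      (cosetDerivation A d : Set (Multiplicative (ZMod n) ≀ᵣ Q))).preimage hFc).inter
      (isClosed_eq ((continuous_of_discreteTopology (f := right)).comp hFc)
        q.continuous_toFun)
  have key : ∀ x, F' x ∈ cosetDerivation A d ∧ (F' x).right = q x := by
    refine fun x => (denseRange_eta G).induction_on x hclosed fun y => ?_
    induction y using Monoid.CoprodI.induction_on with
    | one => simp [one_mem]
    | of i m =>
      change F' (inclusion G i m) ∈ _ ∧ (F' (inclusion G i m)).right = q (inclusion G i m)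
      rw [hF]
      by_cases hi : i = 0
      · subst hi
        simp only [c, if_pos, map_one, MulAut.one_apply, right_inl, and_true]
        exact inl_mem_cosetDerivation A d ⟨m, rfl⟩
      · simp only [c, if_neg hi]
        exact ⟨conj_inl_mem_cosetDerivation A d _, by simp⟩
    | mul x y hx hy =>
      rw [map_mul, map_mul, map_mul]
      exact ⟨mul_mem hx.1 hy.1, by rw [mul_right, hx.2, hy.2]⟩
  have hFh : F' (inclusion G 0 h) = inl (q (inclusion G 0 h)) := by simp [hF, c]
  have hinv : ∀ x, (F' g).left (q (inclusion G 0 h) * x) = (F' g).left x := by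
    intro x
    have := congrFun (congrArg left (hg.map F').eq) (q (inclusion G 0 h) * x)
    simpa [hFh] using this
  -- At `y = 1` the coset sum runs over `A` itself.
  have hprod := (key g).1 1
  simp only [one_mul, inv_one, (key g).2] at hprod
  rw [prod_eq_one_of_mul_left_invariant (⟨q (inclusion G 0 h), h, rfl⟩ : A)
    (fun t : A => (F' g).left t) (fun a => hinv a) (fun e => ?_)] at hprod
  · by_contra hne
    have hgA : q g ∉ A := hne
    simp only [cosetIndicator, if_neg hgA, one_mem, if_true, one_div] at hprod
    exact one_ne_zero (α := ZMod n) (inv_eq_one.mp hprod.symm)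
  · have he : orderOf (⟨q (inclusion G 0 h), h, rfl⟩ : A) = n := Subgroup.orderOf_mk _ _
    rw [he]
    exact toAdd_eq_zero.mp (by simp)

/-- The centralizer of a nontrivial element of `G₁` is contained in `G₁`. -/
theorem exists_inclusion_eq_of_commute {k : ℕ} (G : Fin (k + 1) → ProfiniteGrp.{u})
    {h : G 0} (hh : h ≠ 1) {g : ProfiniteFreeProduct G} (hg : Commute g (inclusion G 0 h)) :
    ∃ t, inclusion G 0 t = g := by
  let R : ClosedSubgroup (ProfiniteFreeProduct G) :=
    { toSubgroup := (inclusion G 0).toMonoidHom.range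
      isClosed' := (isCompact_range (inclusion G 0).continuous_toFun).isClosed }
  suffices hgR : g ∈ (R : Subgroup (ProfiniteFreeProduct G)) from hgR
  rw [ProfiniteGrp.closedSubgroup_eq_sInf_open R, Subgroup.mem_sInf]
  rintro V ⟨hV, hRV⟩
  have hh' : inclusion G 0 h ≠ 1 := fun h1 =>
    hh (inclusion_injective G 0 (h1.trans (map_one _).symm))
  -- `U` avoids `h`, so `h` survives in the quotient, and lies in `V`, so agreement modulo `U`
  -- decides membership in `V`.
  obtain ⟨U, hU⟩ := ProfiniteGrp.exist_openNormalSubgroup_sub_open_nhds_of_one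
    (hV.inter (isOpen_compl_singleton (x := inclusion G 0 h))) ⟨V.one_mem, hh'.symm⟩
  have _ : DiscreteTopology (ProfiniteFreeProduct G ⧸ U.toSubgroup) :=
    QuotientGroup.discreteTopology U.isOpen'
  have _ : Finite (ProfiniteFreeProduct G ⧸ U.toSubgroup) := inferInstance
  let q : ProfiniteFreeProduct G →ₜ* ProfiniteFreeProduct G ⧸ U.toSubgroup :=
    { toMonoidHom := QuotientGroup.mk' U.toSubgroup
      continuous_toFun := QuotientGroup.continuous_mk }
  obtain ⟨t, ht⟩ := exists_map_inclusion_eq_of_commute G q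
    (fun h1 => (hU ((QuotientGroup.eq_one_iff _).mp h1)).2 rfl) hg
  have hmem : (inclusion G 0 t)⁻¹ * g ∈ V := (hU (QuotientGroup.eq.mp ht)).1
  exact (V.mul_mem_cancel_left (V.inv_mem (hRV ⟨t, rfl⟩))).mp hmem

/-- Each factor is a retract of the profinite free product. -/
theorem exists_retraction {k : ℕ} (G : Fin k → ProfiniteGrp.{u}) (i : Fin k) :
    ∃ ρ : ProfiniteFreeProduct G →ₜ* G i, ∀ x, ρ (inclusion G i x) = x := by
  classical
  obtain ⟨F, hF⟩ := exists_lift (G := G) (P := G i)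
    (fun j => if h : j = i then h ▸ ContinuousMonoidHom.id (G j) else 1)
  exact ⟨F, fun x => by simpa using hF i x⟩

/-- The factor `G₁` is malnormal in the profinite free product. -/
theorem exists_inclusion_eq_of_conj {k : ℕ} (G : Fin (k + 1) → ProfiniteGrp.{u})
    {h h' : G 0} (hh : h ≠ 1) {g : ProfiniteFreeProduct G}
    (hg : g * inclusion G 0 h * g⁻¹ = inclusion G 0 h') :
    ∃ t, inclusion G 0 t = g := by
  obtain ⟨ρ, hρ⟩ := exists_retraction G 0
  have hh' : ρ g * h * (ρ g)⁻¹ = h' := by simpa [hρ] using congrArg ρ hg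
  -- Applying `ρ` shows that `ρ g` conjugates `h` to the same `h'` as `g` does.
  have hcomm : Commute ((inclusion G 0 (ρ g))⁻¹ * g) (inclusion G 0 h) := by
    rw [commute_iff_eq, mul_assoc, inv_mul_eq_iff_eq_mul, mul_inv_eq_iff_eq_mul.mp hg, ← hh']
    simp [mul_assoc]
  obtain ⟨t, ht⟩ := exists_inclusion_eq_of_commute G hh hcomm
  exact ⟨ρ g * t, by rw [map_mul, ht, mul_inv_cancel_left]⟩

end ProfiniteFreeProduct

theorem lemma4p6 {k : ℕ} (G : Fin (k + 1) → ProfiniteGrp.{u}) (H : Subgroup (G 0))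
    (hclosed : IsClosed (H : Set (G 0))) (hnontrivial : H ≠ ⊥) :
    Subgroup.normalizer
        ((H.map (ProfiniteFreeProduct.inclusion G 0).toMonoidHom :
          Subgroup (ProfiniteFreeProduct G)) : Set (ProfiniteFreeProduct G)) =
      (Subgroup.normalizer (H : Set (G 0))).map
        (ProfiniteFreeProduct.inclusion G 0).toMonoidHom := by
  let ι := (ProfiniteFreeProduct.inclusion G 0).toMonoidHom
  have hι : Function.Injective ι := ProfiniteFreeProduct.inclusion_injective G 0
  refine le_antisymm (fun g hg => ?_) (Subgroup.le_normalizer_map ι)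
  obtain ⟨h, hhH, hh⟩ := H.bot_or_exists_ne_one.resolve_left hnontrivial
  rw [Subgroup.mem_normalizer_iff] at hg
  obtain ⟨h', _, hh'⟩ := (hg (ι h)).mp ⟨h, hhH, rfl⟩
  obtain ⟨t, rfl⟩ := ProfiniteFreeProduct.exists_inclusion_eq_of_conj G hh hh'.symm
  refine ⟨t, Subgroup.mem_normalizer_iff.mpr fun x => ?_, rfl⟩
  have hx := hg (ι x)
  change ι x ∈ H.map ι ↔ ι t * ι x * (ι t)⁻¹ ∈ H.map ι at hx
  rwa [← map_mul, ← map_inv, ← map_mul, Subgroup.mem_map_iff_mem hι,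
    Subgroup.mem_map_iff_mem hι] at hx
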